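/- Let $\mathcal C$ be a regular category, i.e. a category with finite limits in which every kernel pair has a coequaliser and regular epimorphisms are stable under pullback. Assume that $\mathcal C$ is a Goursat category: for any two effective equivalence relations (kernel pairs) $R$ and $S$ on the same object one has $RSR = SRS$ for the composition of relations. Let $U\colon \mathcal X \to \mathcal C$ be the inclusion of a full (regular epi)-reflective subcategory, i.e. $U$ is full and faithful and has a left adjoint $I\colon \mathcal C \to \mathcal X$ such that every component $\eta_A\colon A \to UI(A)$ of the unit is a regular epimorphism in $\mathcal C$. Then $I$ preserves pullbacks of pairs of split epimorphisms: if $f\colon X \to Y$ and $l\colon Z \to Y$ are split epimorphisms in $\mathcal C$ and $$\begin{array}{ccc} P & \xrightarrow{\ \pi_Z\ } & Z\\ {\scriptstyle \pi_X}\downarrow & & \downarrow {\scriptstyle l}\\ X & \xrightarrow{\ f\ } & Y\end{array}$$ is a pullback in $\mathcal C$, then its image under $I$ is a pullback in $\mathcal X$. -/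

import Mathlib

open CategoryTheory CategoryTheory.Limits

universe v₁ v₂ u₁ u₂

namespace Goursat

section Relations

variable {C : Type u₁} [Category.{v₁} C] [Regular C]

/-- An internal relation from `X` to `Y`: a subobject of `X ⨯ Y`. -/
abbrev Relation (X Y : C) := Subobject (X ⨯ Y)

namespace Relation

/-- The first leg `R ⟶ X` of a relation. -/
noncomputable abbrev fst {X Y : C} (R : Relation X Y) : (R : C) ⟶ X :=
  R.arrow ≫ prod.fst

/-- The second leg `R ⟶ Y` of a relation. -/
noncomputable abbrev snd {X Y : C} (R : Relation X Y) : (R : C) ⟶ Y :=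
  R.arrow ≫ prod.snd

/-- The composite of a relation `R` from `X` to `Y` followed by a relation `S` from `Y` to `Z`:
the image in `X ⨯ Z` of the pullback of the second leg of `R` and the first leg of `S`. -/
noncomputable def comp {X Y Z : C} (R : Relation X Y) (S : Relation Y Z) : Relation X Z :=
  imageSubobject
    (prod.lift (pullback.fst R.snd S.fst ≫ R.fst) (pullback.snd R.snd S.fst ≫ S.snd))

/-- A relation on `X` is an effective equivalence relation when it is the kernel pair of some
morphism with domain `X`. -/
def IsEffectiveEquivalence {X : C} (R : Relation X X) : Prop :=
  ∃ (Y : C) (f : X ⟶ Y), IsKernelPair f R.fst R.snd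

end Relation

end Relations

/-- A regular category is a Goursat category when any two effective equivalence relations `R`, `S`
on the same object are 3-permutable: `RSR = SRS`. -/
class IsGoursat (C : Type u₁) [Category.{v₁} C] [Regular C] : Prop where
  three_permutable : ∀ {X : C} (R S : Relation X X),
    R.IsEffectiveEquivalence → S.IsEffectiveEquivalence →
      (R.comp S).comp R = (S.comp R).comp S

end Goursat

namespace Goursat

section Covers

variable {C : Type u₁} [Category.{v₁} C]

/-! Since `U` is fully faithful, it suffices to show in `C` that the reflected square, a regular
quotient of the pullback along the unit, is again a pullback. The comparison map from the quotient
`P'` to the actual pullback is mono by the shifting property (`eq_of_regularQuotient`) and a strong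
epi by 3-permutability (`exists_cover_pullback`). Relations are handled through generalized
elements, existence being understood up to a regular epi cover. -/

/-- A generalized element which belongs to a subobject on a cover belongs to it. -/
lemma factors_of_cover {X W W' : C} (R : Subobject X) (e : W' ⟶ W) [IsRegularEpi e] (a : W ⟶ X)
    (h : R.Factors (e ≫ a)) : R.Factors a := by
  have sq : CommSq (R.factorThru _ h) e R.arrow a := ⟨by simp⟩
  rw [← sq.fac_right]
  exact Subobject.factors_comp_arrow _

variable [Regular C]

lemma isRegularEpi_of_strongEpi {X Y : C} (f : X ⟶ Y) [StrongEpi f] : IsRegularEpi f :=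
  inferInstance

lemma isRegularEpi_comp {X Y Z : C} (f : X ⟶ Y) (g : Y ⟶ Z) [IsRegularEpi f] [IsRegularEpi g] :
    IsRegularEpi (f ≫ g) :=
  have := strongEpi_comp f g
  isRegularEpi_of_strongEpi _

/-- A generalized element lifts along a regular epimorphism after passing to a cover. -/
lemma exists_cover_lift {X Y W : C} (p : X ⟶ Y) [IsRegularEpi p] (a : W ⟶ Y) :
    ∃ (W' : C) (e : W' ⟶ W) (b : W' ⟶ X), IsRegularEpi e ∧ b ≫ p = e ≫ a :=
  ⟨_, pullback.snd p a, pullback.fst p a, inferInstance, pullback.condition⟩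

lemma factors_imageSubobject_iff {X Y W : C} (f : X ⟶ Y) (a : W ⟶ Y) :
    (imageSubobject f).Factors a ↔
      ∃ (W' : C) (e : W' ⟶ W) (b : W' ⟶ X), IsRegularEpi e ∧ b ≫ f = e ≫ a := by
  constructor
  · intro h
    have : StrongEpi (factorThruImageSubobject f) := by
      dsimp [factorThruImageSubobject]
      exact strongEpi_comp _ _
    obtain ⟨W', e, b, he, hb⟩ :=
      exists_cover_lift (factorThruImageSubobject f) ((imageSubobject f).factorThru a h)
    refine ⟨W', e, b, he, ?_⟩
    simpa using hb =≫ (imageSubobject f).arrow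
  · rintro ⟨W', e, b, he, hb⟩
    apply factors_of_cover _ e
    rw [← hb]
    exact imageSubobject_factors_comp_self _ _

namespace Relation

variable {X Y Z : C}

/-- Composition becomes the usual set-like formula, except that the middle element `c` exists only
on a cover. -/
lemma factors_comp_iff (R : Relation X Y) (S : Relation Y Z) {W : C} (a : W ⟶ X) (b : W ⟶ Z) :
    (R.comp S).Factors (prod.lift a b) ↔
      ∃ (W' : C) (e : W' ⟶ W) (c : W' ⟶ Y), IsRegularEpi e ∧
        R.Factors (prod.lift (e ≫ a) c) ∧ S.Factors (prod.lift c (e ≫ b)) := by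
  rw [comp, factors_imageSubobject_iff]
  constructor
  · rintro ⟨W', e, k, he, hk⟩
    have h₁ := hk =≫ prod.fst
    have h₂ := hk =≫ prod.snd
    simp only [Category.assoc, prod.lift_fst, prod.lift_snd] at h₁ h₂
    refine ⟨W', e, k ≫ pullback.fst R.snd S.fst ≫ R.snd, he, ?_, ?_⟩
    · convert Subobject.factors_comp_arrow (P := R) (k ≫ pullback.fst R.snd S.fst) using 1
      ext <;> simp [h₁, prod.lift_fst, prod.lift_snd]
    · convert Subobject.factors_comp_arrow (P := S) (k ≫ pullback.snd R.snd S.fst) using 1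
      rw [pullback.condition]
      ext <;> simp [h₂, prod.lift_fst, prod.lift_snd]
  · rintro ⟨W', e, c, he, hR, hS⟩
    refine ⟨W', e, pullback.lift (R.factorThru _ hR) (S.factorThru _ hS) ?_, he, ?_⟩
    · simp [prod.lift_fst, prod.lift_snd]
    · ext <;> simp [prod.lift_fst, prod.lift_snd, pullback.lift_fst_assoc,
        pullback.lift_snd_assoc]

instance (f : X ⟶ Y) : Mono (prod.lift (pullback.fst f f) (pullback.snd f f)) where
  right_cancellation a b h := by
    have h₁ := h =≫ prod.fst
    have h₂ := h =≫ prod.snd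
    simp only [Category.assoc, prod.lift_fst, prod.lift_snd] at h₁ h₂
    exact pullback.hom_ext h₁ h₂

/-- The kernel pair of a morphism, as a relation on its domain. -/
noncomputable def ker (f : X ⟶ Y) : Relation X X :=
  Subobject.mk (prod.lift (pullback.fst f f) (pullback.snd f f))

lemma factors_ker_iff (f : X ⟶ Y) {W : C} (a b : W ⟶ X) :
    (ker f).Factors (prod.lift a b) ↔ a ≫ f = b ≫ f := by
  rw [ker, Subobject.mk_factors_iff]
  constructor
  · rintro ⟨k, hk⟩
    change W ⟶ pullback f f at k
    change k ≫ prod.lift (pullback.fst f f) (pullback.snd f f) = _ at hk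
    have h₁ := hk =≫ prod.fst
    have h₂ := hk =≫ prod.snd
    simp only [Category.assoc, prod.lift_fst, prod.lift_snd] at h₁ h₂
    rw [← h₁, ← h₂, Category.assoc, Category.assoc, pullback.condition]
  · intro h
    refine ⟨pullback.lift a b h, ?_⟩
    change pullback.lift a b h ≫ prod.lift (pullback.fst f f) (pullback.snd f f) = _
    ext <;> simp [prod.lift_fst, prod.lift_snd, pullback.lift_fst, pullback.lift_snd]

lemma isEffectiveEquivalence_ker (f : X ⟶ Y) : (ker f).IsEffectiveEquivalence := by
  let i : (ker f : C) ≅ pullback f f := Subobject.underlyingIso (prod.lift (pullback.fst f f) (pullback.snd f f))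
  have hi : i.hom ≫ prod.lift (pullback.fst f f) (pullback.snd f f) = (ker f).arrow :=
    Subobject.underlyingIso_hom_comp_eq_mk _
  have h₁ : i.hom ≫ pullback.fst f f = (ker f).fst := by
    rw [fst, ← hi, Category.assoc, prod.lift_fst]
  have h₂ : i.hom ≫ pullback.snd f f = (ker f).snd := by
    rw [snd, ← hi, Category.assoc, prod.lift_snd]
  exact ⟨Y, f, IsPullback.of_iso_pullback
    ⟨by rw [← h₁, ← h₂, Category.assoc, Category.assoc, pullback.condition]⟩ i h₁ h₂⟩

end Relation

end Covers

section Elements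

variable {C : Type u₁} [Category.{v₁} C] [Regular C] [IsGoursat C]

/-- Three-permutability of the kernel pairs of `f` and `g`, on generalized elements. -/
lemma exists_three_permute {X A B W : C} (f : X ⟶ A) (g : X ⟶ B) (a b c d : W ⟶ X)
    (hab : a ≫ f = b ≫ f) (hbc : b ≫ g = c ≫ g) (hcd : c ≫ f = d ≫ f) :
    ∃ (W' : C) (e : W' ⟶ W) (b' c' : W' ⟶ X), IsRegularEpi e ∧
      e ≫ a ≫ g = b' ≫ g ∧ b' ≫ f = c' ≫ f ∧ c' ≫ g = e ≫ d ≫ g := by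
  have h : (((Relation.ker f).comp (Relation.ker g)).comp (Relation.ker f)).Factors
      (prod.lift a d) := by
    simp only [Relation.factors_comp_iff, Relation.factors_ker_iff]
    exact ⟨W, 𝟙 W, c, inferInstance, ⟨W, 𝟙 W, b, inferInstance, by simpa using hab,
      by simpa using hbc⟩, by simpa using hcd⟩
  rw [IsGoursat.three_permutable _ _ (Relation.isEffectiveEquivalence_ker f)
    (Relation.isEffectiveEquivalence_ker g)] at h
  simp only [Relation.factors_comp_iff, Relation.factors_ker_iff] at h
  obtain ⟨W₁, e₁, c₁, he₁, ⟨W₂, e₂, c₂, he₂, h₁, h₂⟩, h₃⟩ := h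
  refine ⟨W₂, e₂ ≫ e₁, c₂, e₂ ≫ c₁, isRegularEpi_comp _ _, ?_, h₂, ?_⟩
  · simpa using h₁
  · simpa using e₂ ≫= h₃

/-- The shifting lemma for the kernel pairs of `r`, `s` and `t`, where `r` and `s` are jointly
monic. -/
lemma shifting {P A B D W : C} (r : P ⟶ A) (s : P ⟶ B) (t : P ⟶ D)
    (hrs : ∀ {V : C} (a b : V ⟶ P), a ≫ r = b ≫ r → a ≫ s = b ≫ s → a = b)
    (a b c d : W ⟶ P) (hab : a ≫ r = b ≫ r) (hcd : c ≫ r = d ≫ r)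
    (hac : a ≫ s = c ≫ s) (hbd : b ≫ s = d ≫ s) (ht : c ≫ t = d ≫ t) :
    a ≫ t = b ≫ t := by
  -- Pairing `t` with `r` keeps the new middle elements in the `r`-class shared by `a` and `b`, so
  -- joint monicity identifies them.
  obtain ⟨W', e, b', c', he, h₁, h₂, h₃⟩ := exists_three_permute s (prod.lift t r) a c d b hac
    (by ext <;> simp [ht, hcd]) hbd.symm
  have h₁t := h₁ =≫ prod.fst
  have h₁r := h₁ =≫ prod.snd
  have h₃t := h₃ =≫ prod.fst
  have h₃r := h₃ =≫ prod.snd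
  simp only [Category.assoc, prod.lift_fst, prod.lift_snd] at h₁t h₁r h₃t h₃r
  have : b' = c' := hrs _ _ (by rw [← h₁r, h₃r, hab]) h₂
  subst this
  rw [← cancel_epi e, h₁t, h₃t]

/-- For a morphism `(p, q)` of split epimorphisms from `f` to `g`, the kernel pair of `f` covers,
along `p`, the kernel pair of `g`. -/
lemma exists_lift_kernelPair {P X P' X' W : C} {f : P ⟶ X} {i : X ⟶ P} (hi : i ≫ f = 𝟙 X)
    {g : P' ⟶ X'} {j : X' ⟶ P'} {p : P ⟶ P'} {q : X ⟶ X'}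
    [IsRegularEpi p] (hf : f ≫ q = p ≫ g) (hij : i ≫ p = q ≫ j) (a b : W ⟶ P')
    (h : a ≫ g = b ≫ g) :
    ∃ (W' : C) (e : W' ⟶ W) (a' b' : W' ⟶ P), IsRegularEpi e ∧
      a' ≫ p = e ≫ a ∧ b' ≫ p = e ≫ b ∧ a' ≫ f = b' ≫ f := by
  obtain ⟨W₁, e₁, a₁, he₁, ha₁⟩ := exists_cover_lift p a
  obtain ⟨W₂, e₂, b₂, he₂, hb₂⟩ := exists_cover_lift p (e₁ ≫ b)
  have key : (e₂ ≫ a₁) ≫ f ≫ q = b₂ ≫ f ≫ q := by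
    rw [hf, Category.assoc, reassoc_of% ha₁, reassoc_of% hb₂, h]
  -- Each lift is `f`-related to its projection onto the section `i`, and these projections agree
  -- after `p`.
  obtain ⟨W₃, e₃, a₃, b₃, he₃, h₁, h₂, h₃⟩ := exists_three_permute f p (e₂ ≫ a₁)
    ((e₂ ≫ a₁) ≫ f ≫ i) (b₂ ≫ f ≫ i) b₂ (by simp [hi])
    (by simpa [hij] using key =≫ j) (by simp [hi])
  have := isRegularEpi_comp e₂ e₁
  refine ⟨W₃, e₃ ≫ e₂ ≫ e₁, a₃, b₃, isRegularEpi_comp _ _, ?_, ?_, h₂⟩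
  · rw [← h₁]
    simp [ha₁]
  · rw [h₃, hb₂]
    simp

end Elements

section Pullback

variable {C : Type u₁} [Category.{v₁} C] [Regular C] [IsGoursat C]
variable {X Y Z P X' Y' Z' P' : C} {f : X ⟶ Y} {s : Y ⟶ X} {l : Z ⟶ Y} {t : Y ⟶ Z}
  {πX : P ⟶ X} {πZ : P ⟶ Z} {f' : X' ⟶ Y'} {s' : Y' ⟶ X'} {l' : Z' ⟶ Y'} {t' : Y' ⟶ Z'}
  {πX' : P' ⟶ X'} {πZ' : P' ⟶ Z'} {x : X ⟶ X'} {y : Y ⟶ Y'} {z : Z ⟶ Z'} {p : P ⟶ P'}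

/-- A pullback of split epimorphisms covers the pullback of a regular quotient of them. -/
lemma exists_cover_pullback (hP : IsPullback πX πZ f l) (hs : s ≫ f = 𝟙 Y) (ht : t ≫ l = 𝟙 Y)
    (hf : f ≫ y = x ≫ f') (hl : l ≫ y = z ≫ l') (hsx : s ≫ x = y ≫ s') (htz : t ≫ z = y ≫ t')
    [IsRegularEpi x] [IsRegularEpi z] {W : C} (a : W ⟶ X') (b : W ⟶ Z') (h : a ≫ f' = b ≫ l') :
    ∃ (W' : C) (e : W' ⟶ W) (c : W' ⟶ P), IsRegularEpi e ∧
      c ≫ πX ≫ x = e ≫ a ∧ c ≫ πZ ≫ z = e ≫ b := by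
  obtain ⟨W₁, e₁, a₁, he₁, ha₁⟩ := exists_cover_lift x a
  obtain ⟨W₂, e₂, b₂, he₂, hb₂⟩ := exists_cover_lift z (e₁ ≫ b)
  have key : (e₂ ≫ a₁) ≫ f ≫ y = b₂ ≫ l ≫ y := by
    rw [hf, hl, Category.assoc, reassoc_of% ha₁, reassoc_of% hb₂, h]
  let a₂ := e₂ ≫ a₁
  let i : X ⟶ P := hP.lift (𝟙 X) (f ≫ t) (by simp [ht])
  let j : Z ⟶ P := hP.lift (l ≫ s) (𝟙 Z) (by simp [hs])
  let k : Y ⟶ P := hP.lift s t (by simp [hs, ht])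
  have hi₁ : i ≫ πX = 𝟙 X := hP.lift_fst ..
  have hi₂ : i ≫ πZ = f ≫ t := hP.lift_snd ..
  have hj₁ : j ≫ πX = l ≫ s := hP.lift_fst ..
  have hj₂ : j ≫ πZ = 𝟙 Z := hP.lift_snd ..
  have hk₁ : k ≫ πX = s := hP.lift_fst ..
  have hk₂ : k ≫ πZ = t := hP.lift_snd ..
  -- The elements of `X` and `Z` enter `P` by `i` and `j`; the chain links them through the diagonal
  -- section `k`.
  obtain ⟨W₃, e₃, c, d, he₃, h₁, h₂, h₃⟩ :=
    exists_three_permute (πX ≫ f) (prod.lift (πX ≫ x) (πZ ≫ z))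
      (a₂ ≫ i) (a₂ ≫ f ≫ k) (b₂ ≫ l ≫ k) (b₂ ≫ j)
      (by simp [reassoc_of% hi₁, reassoc_of% hk₁, hs])
      (by
        ext
        · simpa [a₂, reassoc_of% hk₁, hsx, prod.lift_fst] using key =≫ s'
        · simpa [a₂, reassoc_of% hk₂, htz, prod.lift_snd] using key =≫ t')
      (by simp [reassoc_of% hj₁, reassoc_of% hk₁])
  have h₁x := h₁ =≫ prod.fst
  have h₃z := h₃ =≫ prod.snd
  simp only [Category.assoc, prod.lift_fst, prod.lift_snd, reassoc_of% hi₁,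
    reassoc_of% hj₂] at h₁x h₃z
  have := isRegularEpi_comp e₂ e₁
  -- `c` is correct over `X'` and `d` over `Z'`; as they agree in `Y`, their coordinates can be
  -- mixed.
  refine ⟨W₃, e₃ ≫ e₂ ≫ e₁, hP.lift (c ≫ πX) (d ≫ πZ) ?_, isRegularEpi_comp _ _, ?_, ?_⟩
  · rw [Category.assoc, h₂, Category.assoc, hP.w]
  · rw [hP.lift_fst_assoc, Category.assoc, ← h₁x]
    simp [a₂, ha₁]
  · rw [hP.lift_snd_assoc, Category.assoc, h₃z, hb₂]
    simp

/-- In a Goursat category, the projections of a regular quotient of a pullback of split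
epimorphisms are jointly monic. -/
lemma eq_of_regularQuotient (hP : IsPullback πX πZ f l) (hs : s ≫ f = 𝟙 Y) (ht : t ≫ l = 𝟙 Y)
    {i' : X' ⟶ P'} {j' : Z' ⟶ P'} (hX : πX ≫ x = p ≫ πX') (hZ : πZ ≫ z = p ≫ πZ')
    (hi : hP.lift (𝟙 X) (f ≫ t) (by simp [ht]) ≫ p = x ≫ i')
    (hj : hP.lift (l ≫ s) (𝟙 Z) (by simp [hs]) ≫ p = z ≫ j')
    [IsRegularEpi p] {W : C} (a b : W ⟶ P') (h₁ : a ≫ πX' = b ≫ πX') (h₂ : a ≫ πZ' = b ≫ πZ') :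
    a = b := by
  obtain ⟨W', e, c, d, he, hc, hd, hcd⟩ :=
    exists_lift_kernelPair (hP.lift_fst _ _ _) hX hi a b h₁
  let j : Z ⟶ P := hP.lift (l ≫ s) (𝟙 Z) (by simp [hs])
  have hj₁ : j ≫ πX = l ≫ s := hP.lift_fst ..
  have hj₂ : j ≫ πZ = 𝟙 Z := hP.lift_snd ..
  rw [← cancel_epi e, ← hc, ← hd]
  -- The lower edge of the shifting rectangle is the projection of `c`, `d` onto the section `j`,
  -- where `p` factors through `z`.
  refine shifting πX πZ p (fun _ _ => hP.hom_ext) c d (c ≫ πZ ≫ j) (d ≫ πZ ≫ j) hcd ?_ ?_ ?_ ?_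
  · simpa [hj₁, hP.w_assoc] using hcd =≫ (f ≫ s)
  · simp [hj₂]
  · simp [hj₂]
  · have hz : c ≫ πZ ≫ z = d ≫ πZ ≫ z := by
      rw [hZ, reassoc_of% hc, reassoc_of% hd, h₂]
    simpa [j, hj] using hz =≫ j'

/-- In a Goursat category, a regular quotient of a pullback of split epimorphisms is a pullback. -/
lemma isPullback_regularQuotient (hP : IsPullback πX πZ f l) (hs : s ≫ f = 𝟙 Y)
    (ht : t ≫ l = 𝟙 Y) (hf : f ≫ y = x ≫ f') (hl : l ≫ y = z ≫ l') (hsx : s ≫ x = y ≫ s')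
    (htz : t ≫ z = y ≫ t') {i' : X' ⟶ P'} {j' : Z' ⟶ P'}
    (hX : πX ≫ x = p ≫ πX') (hZ : πZ ≫ z = p ≫ πZ')
    (hi : hP.lift (𝟙 X) (f ≫ t) (by simp [ht]) ≫ p = x ≫ i')
    (hj : hP.lift (l ≫ s) (𝟙 Z) (by simp [hs]) ≫ p = z ≫ j')
    (w : πX' ≫ f' = πZ' ≫ l') [IsRegularEpi x] [IsRegularEpi z] [IsRegularEpi p] :
    IsPullback πX' πZ' f' l' := by
  let q : P' ⟶ pullback f' l' := pullback.lift πX' πZ' w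
  have hq₁ : q ≫ pullback.fst f' l' = πX' := pullback.lift_fst ..
  have hq₂ : q ≫ pullback.snd f' l' = πZ' := pullback.lift_snd ..
  have : Mono q := ⟨fun a b h => eq_of_regularQuotient hP hs ht hX hZ hi hj a b
    (by rw [← hq₁, reassoc_of% h]) (by rw [← hq₂, reassoc_of% h])⟩
  obtain ⟨W, e, c, he, h₁, h₂⟩ := exists_cover_pullback hP hs ht hf hl hsx htz
    (pullback.fst f' l') (pullback.snd f' l') pullback.condition
  have hce : (c ≫ p) ≫ q = e := by
    apply pullback.hom_ext
    · simp [hq₁, ← hX, h₁]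
    · simp [hq₂, ← hZ, h₂]
  have : StrongEpi ((c ≫ p) ≫ q) := by
    rw [hce]
    infer_instance
  have : StrongEpi q := strongEpi_of_strongEpi (c ≫ p) q
  have := isIso_of_mono_of_strongEpi q
  exact IsPullback.of_iso_pullback ⟨w⟩ (asIso q) hq₁ hq₂

end Pullback

end Goursat

/-- `U` is a full (replete or not) subcategory inclusion of `𝒳` in `C`, with reflector `I`, all of
whose unit components are regular epimorphisms. -/
theorem proposition2p1
    {C : Type u₁} [Category.{v₁} C] [Regular C] [Goursat.IsGoursat C]
    {𝒳 : Type u₂} [Category.{v₂} 𝒳]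
    (U : 𝒳 ⥤ C) [U.Full] [U.Faithful]
    (I : C ⥤ 𝒳) (adj : I ⊣ U)
    (hη : ∀ A : C, IsRegularEpi (adj.unit.app A))
    {X Y Z P : C} (f : X ⟶ Y) (l : Z ⟶ Y) [IsSplitEpi f] [IsSplitEpi l]
    (πX : P ⟶ X) (πZ : P ⟶ Z) (hP : IsPullback πX πZ f l) :
    IsPullback (I.map πX) (I.map πZ) (I.map f) (I.map l) := by
  have nat {A B : C} (g : A ⟶ B) : g ≫ adj.unit.app B = adj.unit.app A ≫ U.map (I.map g) :=
    adj.unit.naturality g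
  have w : I.map πX ≫ I.map f = I.map πZ ≫ I.map l := by
    rw [← I.map_comp, hP.w, I.map_comp]
  refine IsPullback.of_map U w ?_
  exact Goursat.isPullback_regularQuotient hP (IsSplitEpi.id f) (IsSplitEpi.id l) (nat f) (nat l)
    (nat (section_ f)) (nat (section_ l)) (nat πX) (nat πZ) (nat _) (nat _)
    (by simp only [← U.map_comp, w])
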